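/- Let $\mathbb{K}$ be $\mathbb{R}$ or $\mathbb{C}$, let $n,m\in\mathbb{N}_0$, and let $J,R,Q\in\mathbb{K}^{n\times n}$, $B\in\mathbb{K}^{n\times m}$, $S\in\mathbb{K}^{m\times m}$ satisfy $$J=-J^H,\qquad R=R^H\ge 0,\qquad Q=Q^H\ge 0,\qquad S=S^H\ge 0 .$$ Put $$\mathcal{E}:=\begin{bmatrix}0&I_n&0\\-I_n&0&0\\0&0&0\end{bmatrix},\qquad \mathcal{A}_S:=\begin{bmatrix}0&(J-R)Q&B\\((J-R)Q)^H&QRQ&0\\B^H&0&S\end{bmatrix}\in\mathbb{K}^{(2n+m)\times(2n+m)},$$ and assume that the pencil $s\mathcal{E}-\mathcal{A}_S$ is regular, i.e. $\det(s\mathcal{E}-\mathcal{A}_S)\in\mathbb{K}[s]$ is not the zero polynomial. Call $\mu\in\mathbb{K}$ admissible if $\mu\notin\sigma((J-R)Q)\cup\sigma(Q(J+R))$ and $\mu\mathcal{E}-\mathcal{A}_S$ is invertible, where $\sigma$ denotes the set of eigenvalues. For admissible $\mu$ define $$E_\mu:=\begin{bmatrix}0&(J-R)Q-\mu I_n\\((J-R)Q)^H+\mu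 I_n&QRQ\end{bmatrix}^{-1},\qquad S_\mu:=S-\begin{bmatrix}B^H&0\end{bmatrix}E_\mu\begin{bmatrix}B\\0\end{bmatrix},$$ $$N_\mu:=\left(E_\mu+E_\mu\begin{bmatrix}B\\0\end{bmatrix}S_\mu^{-1}\begin{bmatrix}B^H&0\end{bmatrix}E_\mu\right)\begin{bmatrix}0&-I_n\\I_n&0\end{bmatrix}\in\mathbb{K}^{2n\times 2n}$$ (the inverses exist for admissible $\mu$). For a square matrix $M$, let $M^D$ denote its Drazin inverse, i.e. the unique matrix with $M^DM=MM^D$, $M^DMM^D=M^D$ and $M^DM^{k+1}=M^k$ for some $k\in\mathbb{N}_0$. Then for any two admissible $\mu,\nu\in\mathbb{K}$, $$\mathrm{im}\,(N_\mu^DN_\mu)=\mathrm{im}\,(N_\nu^DN_\nu).$$ -/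

import Mathlib

open scoped Matrix ComplexOrder

namespace OptPencil

section Drazin

variable {𝕜 ι : Type*} [Field 𝕜] [Fintype ι] [DecidableEq ι]

/-- `D` is a Drazin inverse of the square matrix `M`. -/
structure IsDrazinInverse (M D : Matrix ι ι 𝕜) : Prop where
  comm : D * M = M * D
  outer : D * M * D = D
  power : ∃ ν : ℕ, D * M ^ (ν + 1) = M ^ ν

theorem IsDrazinInverse.power_of_le {M D : Matrix ι ι 𝕜} {ν k : ℕ}
    (h : D * M ^ (ν + 1) = M ^ ν) (hk : ν ≤ k) : D * M ^ (k + 1) = M ^ k := by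
  obtain ⟨j, rfl⟩ := Nat.exists_eq_add_of_le hk
  rw [show ν + j + 1 = (ν + 1) + j by omega, pow_add, ← mul_assoc, h, ← pow_add]

theorem IsDrazinInverse.outer_pow {M D : Matrix ι ι 𝕜} (h : IsDrazinInverse M D) (k : ℕ) :
    M ^ k * D ^ (k + 1) = D := by
  have hc : Commute D M := h.comm
  induction k with
  | zero => simp
  | succ k ih =>
    calc M ^ (k + 1) * D ^ (k + 1 + 1) = M * (M ^ k * D ^ (k + 1)) * D := by
          rw [pow_succ' M, pow_succ D (k + 1)]; simp only [mul_assoc]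
      _ = D := by rw [ih, ← h.comm, h.outer]

theorem existsUnique_isDrazinInverse (M : Matrix ι ι 𝕜) : ∃! D, IsDrazinInverse M D := by
  have hex : ∃ D, IsDrazinInverse M D := by
    obtain ⟨q, hpq, hq⟩ := Polynomial.exists_eq_pow_rootMultiplicity_mul_and_not_dvd
      (minpoly 𝕜 M) (minpoly.ne_zero (Matrix.isIntegral M)) 0
    set ν := (minpoly 𝕜 M).rootMultiplicity 0
    rw [Polynomial.C_0, sub_zero] at hpq hq
    have hcop : IsCoprime ((Polynomial.X : Polynomial 𝕜) ^ (ν + 1)) q :=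
      ((Polynomial.irreducible_X.coprime_iff_not_dvd).2 hq).pow_left
    obtain ⟨a, b, hab⟩ := hcop
    have hpoly : a * Polynomial.X ^ ν * Polynomial.X ^ (ν + 1) + b * minpoly 𝕜 M
        = Polynomial.X ^ ν := by
      rw [hpq]
      calc _ = Polynomial.X ^ ν * (a * Polynomial.X ^ (ν + 1) + b * q) := by ring
        _ = _ := by rw [hab, mul_one]
    have hY := congrArg (Polynomial.aeval M) hpoly
    simp only [map_add, map_mul, map_pow, Polynomial.aeval_X, minpoly.aeval, mul_zero,
      add_zero] at hY
    set Y : Matrix ι ι 𝕜 := Polynomial.aeval M a * M ^ ν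
    have hYM : Commute Y M :=
      have h : Commute (Polynomial.aeval M a) M := by
        have := (Commute.all a Polynomial.X).map (Polynomial.aeval M)
        rwa [Polynomial.aeval_X] at this
      h.mul_left ((Commute.refl M).pow_left ν)
    have key : ∀ j : ℕ, Y ^ j * M ^ (ν + j) = M ^ ν := by
      intro j
      induction j with
      | zero => simp
      | succ j ih =>
        rw [pow_succ, mul_assoc, show ν + (j + 1) = (ν + 1) + j by omega, pow_add M (ν + 1),
          ← mul_assoc Y, hY, ← pow_add, ih]
    have hk : M ^ ν = Y ^ (ν + 1) * M ^ (ν + (ν + 1)) := (key (ν + 1)).symm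
    have hc1 : Commute (Y ^ (ν + 1)) M := hYM.pow_left _
    refine ⟨Y ^ (ν + 1) * M ^ ν, ?_, ?_, ν, ?_⟩
    · exact hc1.mul_left ((Commute.refl M).pow_left ν)
    · calc Y ^ (ν + 1) * M ^ ν * M * (Y ^ (ν + 1) * M ^ ν)
          = Y ^ (ν + 1) * (M ^ (ν + 1) * Y ^ (ν + 1)) * M ^ ν := by
            rw [pow_succ M]; simp only [mul_assoc]
        _ = Y ^ (ν + 1) * (Y ^ (ν + 1) * M ^ (ν + (ν + 1))) := by
            rw [← (hc1.pow_right (ν + 1)).eq, add_comm ν (ν + 1), pow_add M (ν + 1)]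
            simp only [mul_assoc]
        _ = Y ^ (ν + 1) * M ^ ν := by rw [← hk]
    · rw [mul_assoc, ← pow_add, ← hk]
  obtain ⟨D, hD⟩ := hex
  refine ⟨D, hD, fun D' hD' => ?_⟩
  obtain ⟨i, hi⟩ := hD.power
  obtain ⟨j, hj⟩ := hD'.power
  have h1 := IsDrazinInverse.power_of_le hi (le_max_left i j)
  have h2 := IsDrazinInverse.power_of_le hj (le_max_right i j)
  set k := max i j
  have hc : Commute D M := hD.comm
  have hc' : Commute D' M := hD'.comm
  have e1 : D' = D * M * D' := by
    calc D' = M ^ k * D' ^ (k + 1) := (hD'.outer_pow k).symm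
      _ = D * M * (M ^ k * D' ^ (k + 1)) := by
        rw [← mul_assoc, mul_assoc D M, ← pow_succ', h1]
      _ = D * M * D' := by rw [hD'.outer_pow k]
  have e2 : D = D * M * D' := by
    calc D = M ^ k * D ^ (k + 1) := (hD.outer_pow k).symm
      _ = D ^ (k + 1) * M ^ k := ((hc.pow_right k).pow_left (k + 1)).eq.symm
      _ = D ^ (k + 1) * M ^ k * (M * D') := by
        rw [mul_assoc, ← mul_assoc (M ^ k), ← pow_succ, ← (hc'.pow_right (k + 1)).eq, h2]
      _ = M ^ k * D ^ (k + 1) * (M * D') := by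
        rw [((hc.pow_right k).pow_left (k + 1)).eq]
      _ = D * M * D' := by rw [hD.outer_pow k, mul_assoc]
  rw [e1, ← e2]

/-- The Drazin inverse of a square matrix. -/
noncomputable def drazinInv (M : Matrix ι ι 𝕜) : Matrix ι ι 𝕜 :=
  (existsUnique_isDrazinInverse M).choose

theorem drazinInv_spec (M : Matrix ι ι 𝕜) : IsDrazinInverse M (drazinInv M) :=
  (existsUnique_isDrazinInverse M).choose_spec.1

/-- The pencil `s E - A` is regular: `det (s E - A)` is not the zero polynomial in `s`. -/
def IsRegularPencil (E A : Matrix ι ι 𝕜) : Prop :=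
  ((Polynomial.X : Polynomial 𝕜) • E.map Polynomial.C - A.map Polynomial.C).det ≠ 0

end Drazin

section Blocks

variable {𝕜 : Type*} [RCLike 𝕜] {n m : ℕ}

/-- The leading coefficient `[[0, I, 0], [-I, 0, 0], [0, 0, 0]]` of the optimality pencil. -/
def pencilE (𝕜 : Type*) [RCLike 𝕜] (n m : ℕ) :
    Matrix ((Fin n ⊕ Fin n) ⊕ Fin m) ((Fin n ⊕ Fin n) ⊕ Fin m) 𝕜 :=
  Matrix.fromBlocks (Matrix.fromBlocks 0 1 (-1) 0) 0 0 0

/-- The coefficient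
`[[0, (J - R) Q, B], [((J - R) Q)ᴴ, Q R Q, 0], [Bᴴ, 0, S]]` of the optimality pencil. -/
def pencilA (J R Q : Matrix (Fin n) (Fin n) 𝕜) (B : Matrix (Fin n) (Fin m) 𝕜)
    (S : Matrix (Fin m) (Fin m) 𝕜) :
    Matrix ((Fin n ⊕ Fin n) ⊕ Fin m) ((Fin n ⊕ Fin n) ⊕ Fin m) 𝕜 :=
  Matrix.fromBlocks
    (Matrix.fromBlocks 0 ((J - R) * Q) ((J - R) * Q)ᴴ (Q * R * Q))
    (Matrix.fromRows B 0) (Matrix.fromCols Bᴴ 0) S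

/-- `E_μ = [[0, (J - R) Q - μ I], [((J - R) Q)ᴴ + μ I, Q R Q]]⁻¹`. -/
noncomputable def resolventE (J R Q : Matrix (Fin n) (Fin n) 𝕜) (μ : 𝕜) :
    Matrix (Fin n ⊕ Fin n) (Fin n ⊕ Fin n) 𝕜 :=
  (Matrix.fromBlocks 0 ((J - R) * Q - μ • 1) (((J - R) * Q)ᴴ + μ • 1) (Q * R * Q))⁻¹

/-- `S_μ = S - [Bᴴ 0] E_μ [B; 0]`. -/
noncomputable def schurS (J R Q : Matrix (Fin n) (Fin n) 𝕜) (B : Matrix (Fin n) (Fin m) 𝕜)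
    (S : Matrix (Fin m) (Fin m) 𝕜) (μ : 𝕜) : Matrix (Fin m) (Fin m) 𝕜 :=
  S - Matrix.fromCols Bᴴ (0 : Matrix (Fin m) (Fin n) 𝕜) * resolventE J R Q μ *
    Matrix.fromRows B (0 : Matrix (Fin n) (Fin m) 𝕜)

/-- `N_μ = (E_μ + E_μ [B; 0] S_μ⁻¹ [Bᴴ 0] E_μ) [[0, -I], [I, 0]]`. -/
noncomputable def matN (J R Q : Matrix (Fin n) (Fin n) 𝕜) (B : Matrix (Fin n) (Fin m) 𝕜)
    (S : Matrix (Fin m) (Fin m) 𝕜) (μ : 𝕜) : Matrix (Fin n ⊕ Fin n) (Fin n ⊕ Fin n) 𝕜 :=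
  (resolventE J R Q μ +
    resolventE J R Q μ * Matrix.fromRows B (0 : Matrix (Fin n) (Fin m) 𝕜) *
      (schurS J R Q B S μ)⁻¹ *
      Matrix.fromCols Bᴴ (0 : Matrix (Fin m) (Fin n) 𝕜) * resolventE J R Q μ) *
  Matrix.fromBlocks 0 (-1) 1 0

/-- `μ` is admissible: it is an eigenvalue neither of `(J - R) Q` nor of `Q (J + R)`, and
`μ E - A` is invertible. -/
structure IsAdmissible (J R Q : Matrix (Fin n) (Fin n) 𝕜) (B : Matrix (Fin n) (Fin m) 𝕜)
    (S : Matrix (Fin m) (Fin m) 𝕜) (μ : 𝕜) : Prop where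
  notMem_left : μ ∉ spectrum 𝕜 ((J - R) * Q)
  notMem_right : μ ∉ spectrum 𝕜 (Q * (J + R))
  isUnit : IsUnit (μ • pencilE 𝕜 n m - pencilA J R Q B S)

end Blocks

end OptPencil

namespace OptPencil

section Drazin

variable {𝕜 ι : Type*} [Field 𝕜] [Fintype ι] [DecidableEq ι]

/-! `pencilE` vanishes outside its leading block `E₁₁`, so the resolvent identity for `(A - μ E)⁻¹`
compresses to leading blocks. A Schur complement identifies `N_μ` with `-((A - μ E)⁻¹)₁₁ E₁₁`
(`matN_eq`), hence `N_μ - N_ν = (ν - μ) N_μ N_ν` (`matN_sub_matN`). Thus the `N_μ` commute and `N_μ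
= N_ν (1 + (ν - μ) N_μ)`. A commuting right factor can only shrink the core range
(`range_drazinInv_mul_le`), and exchanging `μ` and `ν` gives equality. -/

/-- The core range `im (Mᴰ M)` of a right multiple `M = M' W`, with `W` commuting with `M'`, is
contained in that of `M'`. -/
theorem range_drazinInv_mul_le {M M' W : Matrix ι ι 𝕜} (hM : M = M' * W) (hW : Commute M' W) :
    LinearMap.range (Matrix.mulVecLin (drazinInv M * M)) ≤
      LinearMap.range (Matrix.mulVecLin (drazinInv M' * M')) := by
  have h := drazinInv_spec M
  -- Only the exponent of `M'` is needed: `Mᴰ = M ^ k (Mᴰ) ^ (k + 1)` holds for every `k`.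
  obtain ⟨k, hk⟩ := (drazinInv_spec M').power
  have key : drazinInv M * M = drazinInv M' * M' *
      (M' ^ k * W ^ k * drazinInv M ^ (k + 1) * M) := by
    calc drazinInv M * M = M ^ k * drazinInv M ^ (k + 1) * M := by rw [h.outer_pow k]
      _ = M' ^ k * W ^ k * drazinInv M ^ (k + 1) * M := by rw [hM, hW.mul_pow]
      _ = drazinInv M' * M' ^ (k + 1) * W ^ k * drazinInv M ^ (k + 1) * M := by rw [hk]
      _ = _ := by simp only [pow_succ' M', mul_assoc]
  rw [key, Matrix.mulVecLin_mul]
  exact LinearMap.range_comp_le_range _ _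

end Drazin

section Blocks

variable {𝕜 : Type*} [RCLike 𝕜] {n m : ℕ}
  {J R Q : Matrix (Fin n) (Fin n) 𝕜} {B : Matrix (Fin n) (Fin m) 𝕜}
  {S : Matrix (Fin m) (Fin m) 𝕜} {μ ν : 𝕜}

theorem pencilA_sub_smul_pencilE (J R Q : Matrix (Fin n) (Fin n) 𝕜)
    (B : Matrix (Fin n) (Fin m) 𝕜) (S : Matrix (Fin m) (Fin m) 𝕜) (μ : 𝕜) :
    pencilA J R Q B S - μ • pencilE 𝕜 n m =
      Matrix.fromBlocks
        (Matrix.fromBlocks 0 ((J - R) * Q - μ • 1) (((J - R) * Q)ᴴ + μ • 1) (Q * R * Q))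
        (Matrix.fromRows B 0) (Matrix.fromCols Bᴴ 0) S := by
  simp [pencilA, pencilE, Matrix.fromBlocks_smul, sub_eq_add_neg, Matrix.fromBlocks_neg,
    Matrix.fromBlocks_add]

theorem IsAdmissible.isUnit_sub (h : IsAdmissible J R Q B S μ) :
    IsUnit (pencilA J R Q B S - μ • pencilE 𝕜 n m) := by
  rw [← neg_sub]
  exact h.isUnit.neg

/-- With a zero corner, invertibility reduces to the antidiagonal blocks. The lower one equals `μ -
Q (J + R)` by the symmetries of `J`, `R`, `Q`, which is why `σ(Q (J + R))` is excluded. -/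
theorem IsAdmissible.isUnit_fromBlocks (hJ : J = -Jᴴ) (hR : R.IsHermitian) (hQ : Q.IsHermitian)
    (h : IsAdmissible J R Q B S μ) :
    IsUnit (Matrix.fromBlocks 0 ((J - R) * Q - μ • 1) (((J - R) * Q)ᴴ + μ • 1) (Q * R * Q)) := by
  have h1 : IsUnit ((J - R) * Q - μ • 1) := by
    have := (spectrum.notMem_iff.1 h.notMem_left).neg
    rwa [neg_sub, Algebra.algebraMap_eq_smul_one] at this
  have h2 : IsUnit (((J - R) * Q)ᴴ + μ • 1) := by
    have := spectrum.notMem_iff.1 h.notMem_right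
    have hJ' : Jᴴ = -J := by rw [eq_neg_iff_add_eq_zero, add_comm, ← eq_neg_iff_add_eq_zero, ← hJ]
    rw [Algebra.algebraMap_eq_smul_one] at this
    convert this using 1
    rw [Matrix.conjTranspose_mul, Matrix.conjTranspose_sub, hJ', hR.eq, hQ.eq, mul_sub, mul_add,
      mul_neg]
    abel
  obtain ⟨X, hX⟩ := h1
  obtain ⟨Y, hY⟩ := h2
  rw [← hX, ← hY]
  refine IsUnit.of_mul_eq_one (Matrix.fromBlocks
    (-(Y⁻¹.1 * (Q * R * Q) * X⁻¹.1)) Y⁻¹.1 X⁻¹.1 0) ?_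
  simp [Matrix.fromBlocks_multiply, ← mul_assoc]

/-- `N_μ` is minus the leading block of `(A - μ E)⁻¹` times the leading block of `E`. -/
theorem matN_eq (hJ : J = -Jᴴ) (hR : R.IsHermitian) (hQ : Q.IsHermitian)
    (h : IsAdmissible J R Q B S μ) :
    matN J R Q B S μ =
      -((pencilA J R Q B S - μ • pencilE 𝕜 n m)⁻¹.toBlocks₁₁ * (pencilE 𝕜 n m).toBlocks₁₁) := by
  have hF := h.isUnit_fromBlocks hJ hR hQ
  have hZ := h.isUnit_sub
  rw [pencilA_sub_smul_pencilE] at hZ ⊢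
  let := hF.invertible
  let := hZ.invertible
  -- The Schur complement `S_μ` is invertible because the full matrix and its leading block are.
  let := (Matrix.isUnit_fromBlocks_iff_of_invertible₁₁.1 hZ).invertible
  rw [← Matrix.invOf_eq_nonsing_inv, Matrix.invOf_fromBlocks₁₁_eq, Matrix.toBlocks_fromBlocks₁₁,
    matN, ← mul_neg]
  simp [schurS, resolventE, pencilE, Matrix.invOf_eq_nonsing_inv, Matrix.fromBlocks_neg]

/-- The resolvent identity for `N`. -/
theorem matN_sub_matN (hJ : J = -Jᴴ) (hR : R.IsHermitian) (hQ : Q.IsHermitian)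
    (hμ : IsAdmissible J R Q B S μ) (hν : IsAdmissible J R Q B S ν) :
    matN J R Q B S μ - matN J R Q B S ν =
      (ν - μ) • (matN J R Q B S μ * matN J R Q B S ν) := by
  rw [matN_eq hJ hR hQ hμ, matN_eq hJ hR hQ hν]
  have hX := hμ.isUnit_sub
  have hY := hν.isUnit_sub
  set X := pencilA J R Q B S - μ • pencilE 𝕜 n m with hXd
  set Y := pencilA J R Q B S - ν • pencilE 𝕜 n m with hYd
  have hYX : Y - X = (μ - ν) • pencilE 𝕜 n m := by rw [hXd, hYd, sub_smul]; abel
  have hres : X⁻¹ - Y⁻¹ = (μ - ν) • (X⁻¹ * pencilE 𝕜 n m * Y⁻¹) := by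
    rw [← Matrix.smul_mul, ← Matrix.mul_smul, ← hYX, mul_sub, sub_mul,
      Matrix.nonsing_inv_mul _ ((Matrix.isUnit_iff_isUnit_det _).1 hX), mul_assoc,
      Matrix.mul_nonsing_inv _ ((Matrix.isUnit_iff_isUnit_det _).1 hY), mul_one, one_mul]
  -- In the product `X⁻¹ E Y⁻¹` only the leading block of `E` contributes, so its leading block
  -- involves no other blocks of the inverses.
  have hblock : X⁻¹.toBlocks₁₁ - Y⁻¹.toBlocks₁₁ =
      (μ - ν) • (X⁻¹.toBlocks₁₁ * (pencilE 𝕜 n m).toBlocks₁₁ * Y⁻¹.toBlocks₁₁) := by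
    have := congrArg Matrix.toBlocks₁₁ hres
    rw [← Matrix.fromBlocks_toBlocks X⁻¹, ← Matrix.fromBlocks_toBlocks Y⁻¹] at this
    simpa [pencilE, Matrix.fromBlocks_multiply, Matrix.fromBlocks_smul, sub_eq_add_neg,
      Matrix.fromBlocks_neg, Matrix.fromBlocks_add] using this
  rw [neg_mul_neg, ← mul_assoc, ← Matrix.smul_mul, ← neg_sub μ ν, neg_smul, ← hblock]
  noncomm_ring

/-- Exchanging `μ` and `ν` negates the left side of the resolvent identity, so both products agree
once `μ - ν ≠ 0` is cancelled. -/
theorem commute_matN (hJ : J = -Jᴴ) (hR : R.IsHermitian) (hQ : Q.IsHermitian)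
    (hμ : IsAdmissible J R Q B S μ) (hν : IsAdmissible J R Q B S ν) :
    Commute (matN J R Q B S μ) (matN J R Q B S ν) := by
  rcases eq_or_ne μ ν with rfl | hne
  · exact Commute.refl _
  · have h1 := matN_sub_matN hJ hR hQ hμ hν
    have h2 := matN_sub_matN hJ hR hQ hν hμ
    rw [← neg_sub, h1, ← neg_smul, neg_sub] at h2
    exact smul_right_injective _ (sub_ne_zero.2 hne) h2

theorem range_drazinInv_matN_le (hJ : J = -Jᴴ) (hR : R.IsHermitian) (hQ : Q.IsHermitian)
    (hμ : IsAdmissible J R Q B S μ) (hν : IsAdmissible J R Q B S ν) :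
    LinearMap.range (Matrix.mulVecLin
        (drazinInv (matN J R Q B S μ) * matN J R Q B S μ)) ≤
      LinearMap.range (Matrix.mulVecLin
        (drazinInv (matN J R Q B S ν) * matN J R Q B S ν)) := by
  have hc := commute_matN hJ hR hQ hν hμ
  refine range_drazinInv_mul_le (W := 1 + (ν - μ) • matN J R Q B S μ) ?_
    ((Commute.one_right _).add_right (hc.smul_right _))
  rw [mul_add, mul_one, Matrix.mul_smul, hc.eq, ← matN_sub_matN hJ hR hQ hμ hν, add_sub_cancel]

end Blocks

end OptPencil

theorem mainTheorem12 {𝕜 : Type*} [RCLike 𝕜] {n m : ℕ}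
    (J R Q : Matrix (Fin n) (Fin n) 𝕜) (B : Matrix (Fin n) (Fin m) 𝕜)
    (S : Matrix (Fin m) (Fin m) 𝕜)
    (hJ : J = -Jᴴ) (hR : R.PosSemidef) (hQ : Q.PosSemidef) (hS : S.PosSemidef)
    (hreg : OptPencil.IsRegularPencil (OptPencil.pencilE 𝕜 n m) (OptPencil.pencilA J R Q B S))
    (μ ν : 𝕜) (hμ : OptPencil.IsAdmissible J R Q B S μ)
    (hν : OptPencil.IsAdmissible J R Q B S ν) :
    LinearMap.range (Matrix.mulVecLin
        (OptPencil.drazinInv (OptPencil.matN J R Q B S μ) * OptPencil.matN J R Q B S μ)) =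
      LinearMap.range (Matrix.mulVecLin
        (OptPencil.drazinInv (OptPencil.matN J R Q B S ν) * OptPencil.matN J R Q B S ν)) :=
  le_antisymm
    (OptPencil.range_drazinInv_matN_le hJ hR.isHermitian hQ.isHermitian hμ hν)
    (OptPencil.range_drazinInv_matN_le hJ hR.isHermitian hQ.isHermitian hν hμ)
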